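/- Consider quantum circuits built from the gates $X$, CNOT, Toffoli, Hadamard, $R_\theta$ (phase $e^{i\theta}$ if the qubit is $1$) and $CR_\theta$ (phase $e^{i\theta}$ if both qubits are $1$), with arbitrary real angles $\theta$; the gate count of a circuit is its number of gates. Let $|x\rangle$ be a register of $n$ qubits and $|z\rangle$ (or $|w\rangle$) a register of $m$ qubits, holding nonnegative integers in binary, and put $N=\max(n,m)$. All circuits below act on exactly these $n+m$ qubits (no ancilla qubits) and implement the stated operators exactly. 1. For every fixed integer $k\ge 2$, the diagonal unitary $$\mathsf{PhaseProduct}(\phi)\,|x\rangle|z\rangle = e^{i\phi xz}\,|x\rangle|z\rangle$$ can be implemented using $O\!\left(N^{\log_k(2k-1)}\right)$ gates, with an implied constant that depends only on $k$. Moreover, for given $n,m$ the circuit can be chosen to consist only of gates $X$, CNOT, Toffoli, $R_\theta$, $CR_\theta$, to be the same for all $\phi\in\mathbb R$ except for the angles, and to have all its angles of the form $\theta=r\phi$ with rational weights $r$ that do not depend on $\phi$. 2. For every fixed integer $k\ge2$ and every integer $a$, the classical-quantum multiplication $$|x\rangle|w\rangle\mapsto|x\rangle|(w+ax)\bmod 2^m\rangle$$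 can be implemented using $O\!\left(N^{\log_k(2k-1)}\right)$ gates, with an implied constant that depends only on $k$. 3. Consequently, for every $\epsilon>0$, this classical-quantum multiplication can be implemented using $O\!\left(N^{1+\epsilon}\right)$ gates, with an implied constant that depends only on $\epsilon$. In particular, for $m=n$ or $m=2n$ the gate counts are $O(n^{\log_k(2k-1)})$ and $O(n^{1+\epsilon})$. -/

import Mathlib

namespace QCircuit

/-- Elementary quantum gates on the qubits `Q`. The angles of the phase rotations are taken from
`Θ`: an actual circuit has `Θ = ℝ`, while `Θ = ℚ` is used for circuit templates, whose angles are
multiples of a parameter to be supplied later (see `Circuit.scale`). -/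
inductive Gate (Θ Q : Type) where
  /-- NOT on the qubit `t` -/
  | X (t : Q)
  /-- NOT on `t`, controlled by `c` -/
  | CNOT (c t : Q) (h : c ≠ t)
  /-- NOT on `t`, controlled by `c₁` and `c₂` -/
  | toffoli (c₁ c₂ t : Q) (h₁₂ : c₁ ≠ c₂) (h₁ : c₁ ≠ t) (h₂ : c₂ ≠ t)
  /-- Hadamard gate on `t` -/
  | H (t : Q)
  /-- phase rotation by `θ` if `t` is 1 -/
  | R (θ : Θ) (t : Q)
  /-- controlled phase rotation: phase rotation by `θ` if both `c` and `t` are 1 -/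
  | CR (θ : Θ) (c t : Q) (h : c ≠ t)

/-- A circuit is a finite list of gates, the first gate of the list being applied first. Its gate
count is the length of the list. It acts on the qubits `Q` and on no others. -/
abbrev Circuit (Θ Q : Type) := List (Gate Θ Q)

/-- The circuit uses no Hadamard gate: all its gates are classical reversible gates (`X`, `CNOT`,
`toffoli`) and (controlled) phase rotations. -/
def Circuit.HadamardFree {Θ Q : Type} (C : Circuit Θ Q) : Prop :=
  ∀ t : Q, Gate.H t ∉ C

/-- Turn a rational angle `r` into the real angle `r * φ`. -/
noncomputable def Gate.scale {Q : Type} (φ : ℝ) : Gate ℚ Q → Gate ℝ Q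
  | .X t => .X t
  | .CNOT c t h => .CNOT c t h
  | .toffoli c₁ c₂ t h₁₂ h₁ h₂ => .toffoli c₁ c₂ t h₁₂ h₁ h₂
  | .H t => .H t
  | .R r t => .R (r * φ) t
  | .CR r c t h => .CR (r * φ) c t h

/-- The actual circuit obtained from a template by multiplying all its rational weights by `φ`. -/
noncomputable def Circuit.scale {Q : Type} (φ : ℝ) (C : Circuit ℚ Q) : Circuit ℝ Q :=
  C.map (Gate.scale φ)

section Semantics

variable {Q : Type} [Fintype Q] [DecidableEq Q]

/-- Operators on the state space of the qubits `Q`, as matrices in the computational basis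
`|b⟩`, `b : Q → Bool`. -/
abbrev Op (Q : Type) := Matrix (Q → Bool) (Q → Bool) ℂ

/-- The operator `|b⟩ ↦ |f b⟩`. -/
def basisMap (f : (Q → Bool) → (Q → Bool)) : Op Q :=
  Matrix.of fun b' b => if b' = f b then 1 else 0

/-- The operator performed by a gate. -/
noncomputable def Gate.op : Gate ℝ Q → Op Q
  | .X t => basisMap fun b => Function.update b t (!b t)
  | .CNOT c t _ => basisMap fun b => Function.update b t (b c ^^ b t)
  | .toffoli c₁ c₂ t _ _ _ => basisMap fun b => Function.update b t ((b c₁ && b c₂) ^^ b t)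
  | .H t => Matrix.of fun b' b =>
      if ∀ s, s ≠ t → b' s = b s then
        (if b' t = true ∧ b t = true then -1 else 1) / (Real.sqrt 2 : ℂ)
      else 0
  | .R θ t => Matrix.diagonal fun b => if b t then Complex.exp (Complex.I * θ) else 1
  | .CR θ c t _ => Matrix.diagonal fun b =>
      if b c && b t then Complex.exp (Complex.I * θ) else 1

/-- The operator performed by a circuit. -/
noncomputable def Circuit.op : Circuit ℝ Q → Op Q
  | [] => 1
  | g :: C => Circuit.op C * g.op

end Semantics

/-- The value of the first register (`n` qubits, least significant bit first). -/
def fstVal {n m : ℕ} (b : Fin n ⊕ Fin m → Bool) : ℕ := Nat.ofBits fun i => b (Sum.inl i)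

/-- The value of the second register (`m` qubits, least significant bit first). -/
def sndVal {n m : ℕ} (b : Fin n ⊕ Fin m → Bool) : ℕ := Nat.ofBits fun i => b (Sum.inr i)

/-- `PhaseProduct(φ) |x⟩|z⟩ = exp(i φ x z) |x⟩|z⟩`, where `x` has `n` bits and `z` has `m` bits. -/
noncomputable def phaseProduct (n m : ℕ) (φ : ℝ) : Op (Fin n ⊕ Fin m) :=
  Matrix.diagonal fun b => Complex.exp (Complex.I * φ * fstVal b * sndVal b)

/-- Classical-quantum multiplication `|x⟩|w⟩ ↦ |x⟩|w + a x⟩`, where `x` has `n` bits, `w` has `m`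
bits, and the second register is understood modulo `2 ^ m`. -/
noncomputable def cqMul (n m : ℕ) (a : ℤ) : Op (Fin n ⊕ Fin m) :=
  Matrix.of fun b' b =>
    if fstVal b' = fstVal b ∧ (sndVal b' : ℤ) = (sndVal b + a * fstVal b) % 2 ^ m then 1 else 0

end QCircuit

/-! A Hadamard-free circuit permutes basis states and multiplies them by phases. The diagonal phases
`f` reachable in this way (`HasPhaseCircuit`) are closed under sums, rational multiples, and
substitution of a classical computation that is undone afterwards. So an identity between functions
of the bits becomes a circuit, and only its cost has to be counted.

The identity is that of Toom-Cook. Cut both registers into `k` blocks of `s` bits, regarded as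
coefficients of polynomials `U`, `V`; their product at `2 ^ s` is a fixed rational combination of
`U(l) V(l)` for the `2k - 1` points `l = 0, …, 2k-2`. The coefficients go into the angles, so
interpolation costs nothing.

Without ancillas there is no room for `U(l)`. It is accumulated in place in the lowest block, by
repeatedly adding the other blocks modulo a power of two. Each overflow is made visible in some
qubit and paid for by a phase linear in that bit, at cost `O(N)`; the value `U(l)` itself is never
stored. The adder needs a carry-in qubit, so one qubit of unknown value is split off each register
and its contribution subtracted again. Thus each point needs one product of two blocks plus `O(N)`
gates (`phase_at_point`), and `T(N) ≤ (2k-1) T(N/k) + O(N)` gives the exponent `log_k (2k-1)`.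

For multiplication by `a`, the Fourier transform of the second register turns addition of `a x` into
a phase product (`phase_mul_fourier`). The transform is built by halving, the two halves being
coupled by one phase product (`fourier_append`); as the exponent exceeds 1, the recursion adds no
logarithm. The exponent tends to 1 as `k` grows. -/

namespace QCircuit

/-! ### Circuits without Hadamard gates: permutations of basis states with phases -/

section Templates

variable {Q : Type}

/-- The phase acquired by a basis state under a gate. -/
def Gate.weight : Gate ℚ Q → (Q → Bool) → ℚ
  | .R r t, b => if b t then r else 0
  | .CR r c t _, b => if b c && b t then r else 0
  | _, _ => 0

/-- The gate is `X`, `CNOT` or `toffoli`. -/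
def Gate.IsClassical : Gate ℚ Q → Prop
  | .X _ => True
  | .CNOT _ _ _ => True
  | .toffoli _ _ _ _ _ _ => True
  | _ => False

/-- All gates are `X`, `CNOT` or `toffoli`. -/
def Circuit.IsClassical (C : Circuit ℚ Q) : Prop := ∀ g ∈ C, g.IsClassical

theorem Gate.IsClassical.weight_eq_zero {g : Gate ℚ Q} (h : g.IsClassical) (b : Q → Bool) :
    g.weight b = 0 := by
  cases g <;> first | rfl | exact h.elim

theorem Circuit.IsClassical.reverse {C : Circuit ℚ Q} (h : C.IsClassical) :
    Circuit.IsClassical C.reverse := fun g hg => h g (List.mem_reverse.1 hg)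

theorem Circuit.IsClassical.hadamardFree {C : Circuit ℚ Q} (h : C.IsClassical) :
    C.HadamardFree := fun _ ht => h _ ht

theorem Circuit.IsClassical.append {C D : Circuit ℚ Q} (hC : C.IsClassical) (hD : D.IsClassical) :
    Circuit.IsClassical (C ++ D) := by
  intro g hg
  rcases List.mem_append.1 hg with h | h
  exacts [hC g h, hD g h]

theorem Circuit.HadamardFree.append {Θ : Type} {C D : Circuit Θ Q} (hC : C.HadamardFree)
    (hD : D.HadamardFree) : Circuit.HadamardFree (C ++ D) := by
  intro t ht
  rcases List.mem_append.1 ht with h | h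
  exacts [hC t h, hD t h]

variable [DecidableEq Q]

/-- The action of a gate on basis states, phases being ignored (and `H` acting trivially). -/
def Gate.act : Gate ℚ Q → (Q → Bool) → (Q → Bool)
  | .X t, b => Function.update b t (!b t)
  | .CNOT c t _, b => Function.update b t (b c ^^ b t)
  | .toffoli c₁ c₂ t _ _ _, b => Function.update b t ((b c₁ && b c₂) ^^ b t)
  | _, b => b

/-- The action of a template on basis states, phases being ignored. -/
def Circuit.act : Circuit ℚ Q → (Q → Bool) → (Q → Bool)
  | [], b => b
  | g :: C, b => Circuit.act C (g.act b)

/-- The phase acquired by a basis state under a template. -/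
def Circuit.weight : Circuit ℚ Q → (Q → Bool) → ℚ
  | [], _ => 0
  | g :: C, b => g.weight b + Circuit.weight C (g.act b)

theorem Circuit.act_append (C D : Circuit ℚ Q) (b : Q → Bool) :
    Circuit.act (C ++ D) b = Circuit.act D (Circuit.act C b) := by
  induction C generalizing b with
  | nil => rfl
  | cons g C ih => exact ih _

theorem Circuit.weight_append (C D : Circuit ℚ Q) (b : Q → Bool) :
    Circuit.weight (C ++ D) b = Circuit.weight C b + Circuit.weight D (Circuit.act C b) := by
  induction C generalizing b with
  | nil => simp [Circuit.weight, Circuit.act]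
  | cons g C ih => simp [Circuit.weight, Circuit.act, ih, add_assoc]

theorem Gate.IsClassical.act_act {g : Gate ℚ Q} (h : g.IsClassical) (b : Q → Bool) :
    g.act (g.act b) = b := by
  cases g with
  | X t => simp [Gate.act]
  | CNOT c t hct => simp [Gate.act, Function.update_of_ne hct]
  | toffoli c₁ c₂ t h₁₂ h₁ h₂ =>
    simp [Gate.act, Function.update_of_ne h₁, Function.update_of_ne h₂]
  | _ => exact h.elim

theorem Circuit.IsClassical.act_reverse {C : Circuit ℚ Q} (h : C.IsClassical) (b : Q → Bool) :
    Circuit.act C.reverse (Circuit.act C b) = b := by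
  induction C generalizing b with
  | nil => rfl
  | cons g C ih =>
    have h' := List.forall_mem_cons.1 h
    rw [List.reverse_cons, Circuit.act_append]
    simp only [Circuit.act]
    rw [ih h'.2]
    exact h'.1.act_act b

theorem Circuit.IsClassical.weight_eq_zero {C : Circuit ℚ Q} (h : C.IsClassical) (b : Q → Bool) :
    Circuit.weight C b = 0 := by
  induction C generalizing b with
  | nil => rfl
  | cons g C ih =>
    have h' := List.forall_mem_cons.1 h
    simp [Circuit.weight, h'.1.weight_eq_zero, ih h'.2]

end Templates

/-! ### Operators of Hadamard-free templates -/

section TemplateSemantics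

variable {Q : Type} [Fintype Q] [DecidableEq Q]

theorem Gate.op_scale {g : Gate ℚ Q} (hg : ∀ t, g ≠ .H t) (φ : ℝ) :
    (g.scale φ).op = Matrix.of fun b' b =>
      if b' = g.act b then Complex.exp (Complex.I * φ * (g.weight b : ℚ)) else 0 := by
  ext b' b
  cases g with
  | H t => exact absurd rfl (hg t)
  | R r t =>
    simp only [Gate.scale, Gate.op, Gate.act, Gate.weight, Matrix.diagonal_apply, Matrix.of_apply]
    by_cases h : b' = b
    · subst h
      by_cases ht : b' t <;> simp [ht]
      ring_nf
    · simp [h]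
  | CR r c t _ =>
    simp only [Gate.scale, Gate.op, Gate.act, Gate.weight, Matrix.diagonal_apply, Matrix.of_apply]
    by_cases h : b' = b
    · subst h
      by_cases ht : (b' c && b' t) = true
      · simp only [ht, if_true]; congr 1; push_cast; ring
      · simp [ht]
    · simp [h]
  | _ => simp [Gate.scale, Gate.op, Gate.act, Gate.weight, basisMap]

theorem Circuit.op_scale {T : Circuit ℚ Q} (hT : T.HadamardFree) (φ : ℝ) :
    (T.scale φ).op = Matrix.of fun b' b =>
      if b' = T.act b then Complex.exp (Complex.I * φ * (T.weight b : ℚ)) else 0 := by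
  induction T with
  | nil =>
    ext b' b
    simp [Circuit.scale, Circuit.op, Circuit.act, Circuit.weight, Matrix.one_apply]
  | cons g T ih =>
    have hT' : Circuit.HadamardFree T := fun t ht => hT t (List.mem_cons_of_mem _ ht)
    have hg : ∀ t, g ≠ .H t := fun t ht => hT t (by simp [ht])
    have ih' := ih hT'
    simp only [Circuit.scale, List.map_cons, Circuit.op] at ih' ⊢
    rw [ih', Gate.op_scale hg]
    ext b' b
    rw [Matrix.mul_apply, Finset.sum_eq_single (g.act b)]
    · have hact : Circuit.act (g :: T) b = Circuit.act T (g.act b) := rfl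
      have hweight : Circuit.weight (g :: T) b = g.weight b + Circuit.weight T (g.act b) := rfl
      simp only [Matrix.of_apply, hact, hweight, if_true]
      by_cases h : b' = Circuit.act T (g.act b)
      · rw [if_pos h, if_pos h, ← Complex.exp_add]; congr 1; push_cast; ring
      · rw [if_neg h, if_neg h, zero_mul]
    · intro c _ hc
      simp [hc]
    · simp

end TemplateSemantics

section Registers

variable {Q : Type}

/-- The value of a bit, as a number. -/
def bit (q : Q) (b : Q → Bool) : ℕ := (b q).toNat

/-- The number with binary digits in the given qubits, least significant bit first. -/
def val : List Q → (Q → Bool) → ℕ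
  | [], _ => 0
  | q :: qs, b => bit q b + 2 * val qs b

end Registers

/-! ### Circuits that multiply basis states by phases -/

section Phase

variable {Q : Type} [DecidableEq Q]

/-- With at most `n` gates and no Hadamard gate one can multiply the basis state `|b⟩` by the phase
`f b` (in units of the angle). -/
def HasPhaseCircuit (f : (Q → Bool) → ℚ) (n : ℕ) : Prop :=
  ∃ T : Circuit ℚ Q, T.HadamardFree ∧ T.length ≤ n ∧ ∀ b, T.act b = b ∧ T.weight b = f b

theorem HasPhaseCircuit.congr {f g : (Q → Bool) → ℚ} {n m : ℕ} (h : HasPhaseCircuit f n)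
    (hfg : ∀ b, g b = f b) (hnm : n ≤ m) : HasPhaseCircuit g m := by
  obtain ⟨T, h₁, h₂, h₃⟩ := h
  exact ⟨T, h₁, h₂.trans hnm, fun b => ⟨(h₃ b).1, by rw [(h₃ b).2, hfg]⟩⟩

theorem HasPhaseCircuit.zero : HasPhaseCircuit (fun _ : Q → Bool => 0) 0 :=
  ⟨[], by simp [Circuit.HadamardFree], by simp, fun b => ⟨rfl, rfl⟩⟩

theorem HasPhaseCircuit.add {f g : (Q → Bool) → ℚ} {n m : ℕ} (hf : HasPhaseCircuit f n)
    (hg : HasPhaseCircuit g m) : HasPhaseCircuit (fun b => f b + g b) (n + m) := by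
  obtain ⟨T, h₁, h₂, h₃⟩ := hf
  obtain ⟨S, k₁, k₂, k₃⟩ := hg
  refine ⟨T ++ S, h₁.append k₁, by rw [List.length_append]; omega, fun b => ?_⟩
  rw [Circuit.act_append, Circuit.weight_append, (h₃ b).1, (h₃ b).2, (k₃ b).1, (k₃ b).2]
  exact ⟨rfl, rfl⟩

/-- Compute, apply the phase, uncompute: a classical circuit is inverted by reversing it, since each
of its gates is an involution. -/
theorem HasPhaseCircuit.conj {f : (Q → Bool) → ℚ} {n a : ℕ} (hf : HasPhaseCircuit f n)
    {A : Circuit ℚ Q} (hA : A.IsClassical) (ha : A.length ≤ a) :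
    HasPhaseCircuit (fun b => f (A.act b)) (n + 2 * a) := by
  obtain ⟨T, h₁, h₂, h₃⟩ := hf
  refine ⟨A ++ (T ++ A.reverse), hA.hadamardFree.append (h₁.append hA.reverse.hadamardFree),
    by simp only [List.length_append, List.length_reverse]; omega, fun b => ?_⟩
  rw [Circuit.act_append, Circuit.act_append, Circuit.weight_append, Circuit.weight_append,
    (h₃ _).1, (h₃ _).2, hA.act_reverse, hA.weight_eq_zero, hA.reverse.weight_eq_zero]
  simp

/-- Multiply the weight of a gate by a constant. -/
def Gate.mulWeight (r : ℚ) : Gate ℚ Q → Gate ℚ Q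
  | .R s t => .R (r * s) t
  | .CR s c t h => .CR (r * s) c t h
  | g => g

theorem HasPhaseCircuit.const_mul {f : (Q → Bool) → ℚ} {n : ℕ} (hf : HasPhaseCircuit f n) (r : ℚ) :
    HasPhaseCircuit (fun b => r * f b) n := by
  obtain ⟨T, h₁, h₂, h₃⟩ := hf
  refine ⟨T.map (Gate.mulWeight r), fun t ht => ?_, by simpa using h₂, fun b => ?_⟩
  · obtain ⟨g, hg, hgt⟩ := List.mem_map.1 ht
    cases g with
    | H s => exact h₁ s hg
    | _ => simp [Gate.mulWeight] at hgt
  · have key : ∀ (T : Circuit ℚ Q) (b : Q → Bool),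
        Circuit.act (T.map (Gate.mulWeight r)) b = Circuit.act T b ∧
          Circuit.weight (T.map (Gate.mulWeight r)) b = r * Circuit.weight T b := by
      intro T
      induction T with
      | nil => intro b; simp [Circuit.act, Circuit.weight]
      | cons g T ih =>
        intro b
        have hact : (g.mulWeight r).act b = g.act b := by cases g <;> rfl
        have hweight : (g.mulWeight r).weight b = r * g.weight b := by
          cases g <;> simp [Gate.mulWeight, Gate.weight]
        simp only [List.map_cons, Circuit.act, Circuit.weight, hact, hweight, ih, mul_add]
        simp
    rw [(key T b).1, (key T b).2, (h₃ b).1, (h₃ b).2]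
    exact ⟨rfl, rfl⟩

theorem HasPhaseCircuit.bit_mul_bit {p q : Q} (h : p ≠ q) :
    HasPhaseCircuit (fun b => (bit p b * bit q b : ℚ)) 1 := by
  refine ⟨[.CR 1 p q h], by simp [Circuit.HadamardFree], by simp, fun b => ⟨rfl, ?_⟩⟩
  cases hp : b p <;> cases hq : b q <;> simp [Circuit.weight, Gate.weight, bit, hp, hq]

theorem HasPhaseCircuit.sum_range (s : ℕ) {f : ℕ → (Q → Bool) → ℚ} {n : ℕ}
    (h : ∀ i < s, HasPhaseCircuit (f i) n) :
    HasPhaseCircuit (fun b => ∑ i ∈ Finset.range s, f i b) (s * n) := by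
  induction s with
  | zero => exact HasPhaseCircuit.zero.congr (by simp) (by simp)
  | succ s ih =>
    exact ((ih fun i hi => h i (by omega)).add (h s (by omega))).congr
      (fun b => Finset.sum_range_succ _ _) (le_of_eq (by ring))

theorem HasPhaseCircuit.mul_val {g : (Q → Bool) → ℚ} {n : ℕ} (xs : List Q)
    (h : ∀ q ∈ xs, HasPhaseCircuit (fun b => g b * (bit q b : ℚ)) n) :
    HasPhaseCircuit (fun b => g b * (val xs b : ℚ)) (xs.length * n) := by
  induction xs with
  | nil => exact HasPhaseCircuit.zero.congr (by simp [val]) (by simp)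
  | cons q xs ih =>
    rw [List.forall_mem_cons] at h
    refine (h.1.add ((ih h.2).const_mul 2)).congr (fun b => ?_)
      (by rw [List.length_cons]; exact le_of_eq (by ring))
    simp only [val]; push_cast; ring

theorem HasPhaseCircuit.bit_mul_val {p : Q} {xs : List Q} (h : p ∉ xs) :
    HasPhaseCircuit (fun b => (bit p b * val xs b : ℚ)) xs.length :=
  (HasPhaseCircuit.mul_val xs fun _ hq =>
    HasPhaseCircuit.bit_mul_bit (ne_of_mem_of_not_mem hq h).symm).congr (fun _ => rfl) (by simp)

/-- Schoolbook multiplication, one `CR` per pair of bits. It serves small registers and the few bits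
left over by the division into blocks. -/
theorem HasPhaseCircuit.val_mul_val {xs zs : List Q} (h : xs.Disjoint zs) :
    HasPhaseCircuit (fun b => (val xs b * val zs b : ℚ)) (xs.length * zs.length) :=
  (HasPhaseCircuit.mul_val (g := fun b => (val zs b : ℚ)) xs fun _ hq =>
    (HasPhaseCircuit.bit_mul_val fun hz => h hq hz).congr (fun _ => mul_comm _ _) le_rfl).congr
      (fun _ => mul_comm _ _) le_rfl

end Phase

/-! ### Registers -/

section Registers

variable {Q : Type}

theorem val_congr {xs : List Q} {b b' : Q → Bool} (h : ∀ q ∈ xs, b q = b' q) :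
    val xs b = val xs b' := by
  induction xs with
  | nil => rfl
  | cons q xs ih =>
    rw [List.forall_mem_cons] at h
    simp only [val, bit, ih h.2, h.1]

theorem val_append (xs ys : List Q) (b : Q → Bool) :
    val (xs ++ ys) b = val xs b + 2 ^ xs.length * val ys b := by
  induction xs with
  | nil => simp [val]
  | cons q xs ih => simp only [List.cons_append, val, ih, List.length_cons, pow_succ]; ring

end Registers

/-! ### Ripple-carry addition without clean ancilla qubits -/

section Adder

variable {Q : Type} [DecidableEq Q]

/-- Ripple-carry addition of the register `as` and the carry bit `c` to the register `ys` modulo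
`2 ^ ys.length`, where only the lowest `as.length` bits of `ys` are changed: the addition is
performed by `A`, and the carry that it discards is found in the qubit `q` after applying `M`. -/
theorem exists_adder (as ys : List Q) (c : Q) (hlen : as.length ≤ ys.length)
    (hnd : (c :: (as ++ ys)).Nodup) :
    ∃ A M : Circuit ℚ Q, ∃ q ∈ c :: as, A.IsClassical ∧ M.IsClassical ∧
      A.length ≤ 6 * as.length ∧ M.length ≤ 3 * as.length ∧ ∀ b,
        (∀ r, r ∉ ys → A.act b r = b r) ∧
        (∀ r, r ∉ c :: (as ++ ys) → M.act b r = b r) ∧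
        val ys (A.act b) + 2 ^ as.length * bit q (M.act b) = val ys b + val as b + bit c b := by
  induction as generalizing ys c with
  | nil =>
    -- With no bits to add, the discarded carry is the carry-in itself.
    refine ⟨[], [], c, by simp, by simp [Circuit.IsClassical], by simp [Circuit.IsClassical],
      by simp, by simp, fun b => ⟨fun _ _ => rfl, fun _ _ => rfl, ?_⟩⟩
    simp [Circuit.act, val]
  | cons a as ih =>
    obtain _ | ⟨y, ys⟩ := ys
    · simp at hlen
    have hnd' : (a :: (as ++ ys)).Nodup := by
      simp only [List.cons_append, List.nodup_cons, List.mem_append, List.mem_cons,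
        List.nodup_append] at hnd ⊢
      grind
    obtain ⟨A, M, q, hq, hA, hM, hAl, hMl, hb⟩ := ih ys a (by simpa using hlen) hnd'
    simp only [List.cons_append, List.nodup_cons, List.mem_append, List.mem_cons,
        List.nodup_append, not_or] at hnd
    have hay : a ≠ y := hnd.2.1.2.1
    have hac : a ≠ c := fun h => hnd.1.1 h.symm
    have hcy : c ≠ y := hnd.1.2.2.1
    have hcys : c ∉ ys := hnd.1.2.2.2
    have hays : a ∉ ys := hnd.2.1.2.2
    have hyys : y ∉ ys := hnd.2.2.2.1.1
    have hcas : c ∉ as := hnd.1.2.1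
    have haas : a ∉ as := hnd.2.1.1
    have hyas : y ∉ as := fun h => hnd.2.2.2.2 y h y (by simp) rfl
    -- `m` leaves the majority of `a`, `y`, `c` in `a`, which is the carry into the next position;
    -- `u` later restores `a` and `c` and writes the sum bit to `y`. In `m ++ M` nothing is
    -- restored, so the last carry remains readable.
    let m : Circuit ℚ Q := [.CNOT a y hay, .CNOT a c hac, .toffoli c y a hcy hac.symm hay.symm]
    let u : Circuit ℚ Q := [.toffoli c y a hcy hac.symm hay.symm, .CNOT a c hac, .CNOT c y hcy]
    have hm : m.IsClassical := by simp [m, Circuit.IsClassical, Gate.IsClassical]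
    have hu : u.IsClassical := by simp [u, Circuit.IsClassical, Gate.IsClassical]
    refine ⟨m ++ (A ++ u), m ++ M, q, List.mem_cons_of_mem _ hq, hm.append (hA.append hu),
      hm.append hM, by simp [m, u]; omega, by simp [m]; omega, fun b => ?_⟩
    simp only [Circuit.act_append]
    have hmr : ∀ r, r ≠ c → r ≠ y → r ≠ a → m.act b r = b r := by
      intro r h₁ h₂ h₃
      simp [m, Circuit.act, Gate.act, h₁, h₂, h₃]
    have hmy : m.act b y = (b a ^^ b y) := by
      simp [m, Circuit.act, Gate.act, hay.symm, hcy.symm, hac, hcy]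
    have hmc : m.act b c = (b a ^^ b c) := by
      simp [m, Circuit.act, Gate.act, hac.symm, hcy, hac, hay]
    have hma : m.act b a = (((b a ^^ b c) && (b a ^^ b y)) ^^ b a) := by
      simp [m, Circuit.act, Gate.act, hac, hcy, hcy.symm, hay]
    generalize m.act b = b₁ at *
    obtain ⟨h₁, h₂, h₃⟩ := hb b₁
    have e₁ := h₁ c hcys
    have e₂ := h₁ a hays
    have e₃ := h₁ y hyys
    have hv : val ys (u.act (A.act b₁)) = val ys (A.act b₁) := by
      refine val_congr fun r hr => ?_
      have : r ≠ c := ne_of_mem_of_not_mem hr hcys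
      have : r ≠ a := ne_of_mem_of_not_mem hr hays
      have : r ≠ y := ne_of_mem_of_not_mem hr hyys
      simp [u, Circuit.act, Gate.act, *]
    have hur : ∀ r, r ≠ c → r ≠ y → r ≠ a → u.act (A.act b₁) r = A.act b₁ r := by
      intro r h₁ h₂ h₃
      simp [u, Circuit.act, Gate.act, h₁, h₂, h₃]
    have huc : u.act (A.act b₁) c = b c := by
      simp [u, Circuit.act, Gate.act, hac.symm, hcy, e₁, e₂, e₃, hma, hmc, hmy]
    have hua : u.act (A.act b₁) a = b a := by
      simp [u, Circuit.act, Gate.act, hac, hay, e₁, e₂, e₃, hma, hmc, hmy]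
    have huy : u.act (A.act b₁) y = (b a ^^ b y ^^ b c) := by
      simp [u, Circuit.act, Gate.act, hac.symm, hcy.symm, hay.symm, e₁, e₂, e₃, hma,
        hmc, hmy]
      cases b a <;> cases b y <;> cases b c <;> rfl
    refine ⟨fun r hr => ?_, fun r hr => ?_, ?_⟩
    · simp only [List.mem_cons, not_or] at hr
      by_cases hrc : r = c
      · rw [hrc, huc]
      by_cases hra : r = a
      · rw [hra, hua]
      rw [hur r hrc hr.1 hra, h₁ r hr.2, hmr r hrc hr.1 hra]
    · simp only [List.cons_append, List.mem_append, List.mem_cons, not_or] at hr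
      rw [h₂ r (by simp; tauto), hmr r hr.1 hr.2.2.2.1 hr.2.1]
    · have v₁ : val ys b₁ = val ys b := val_congr fun r hr => hmr r
        (ne_of_mem_of_not_mem hr hcys) (ne_of_mem_of_not_mem hr hyys)
        (ne_of_mem_of_not_mem hr hays)
      have v₂ : val as b₁ = val as b := val_congr fun r hr => hmr r
        (ne_of_mem_of_not_mem hr hcas) (ne_of_mem_of_not_mem hr hyas)
        (ne_of_mem_of_not_mem hr haas)
      rw [v₁, v₂] at h₃
      simp only [val, hv, List.length_cons, pow_succ]
      have hbits : bit y (u.act (A.act b₁)) + 2 * bit a b₁ = bit y b + bit a b + bit c b := by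
        simp only [bit, huy, hma]
        cases b a <;> cases b y <;> cases b c <;> rfl
      linarith

/-- Phases proportional to a sum of blocks, computed by repeated in-place addition to `ys`. -/
theorem HasPhaseCircuit.accumulate {ys : List Q} {c : Q} {X : Set Q} {g : (Q → Bool) → ℚ}
    (hg : DependsOn g Xᶜ) (hc : c ∈ X) (hys : ∀ q ∈ ys, q ∈ X) {m n : ℕ}
    (hbit : ∀ q ∈ X, HasPhaseCircuit (fun b => bit q b * g b) m)
    (hval : HasPhaseCircuit (fun b => val ys b * g b) n) (blocks : List (List Q))
    (hblocks : ∀ as ∈ blocks, (∀ q ∈ as, q ∈ X) ∧ as.length ≤ ys.length ∧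
      (c :: (as ++ ys)).Nodup) :
    HasPhaseCircuit
      (fun b => (val ys b + (blocks.map fun as => (val as b + bit c b : ℚ)).sum) * g b)
      (n + blocks.length * (m + 18 * ys.length)) := by
  induction blocks with
  | nil => exact hval.congr (by simp) (by simp)
  | cons as blocks ih =>
    rw [List.forall_mem_cons] at hblocks
    obtain ⟨⟨hasX, hlen, hnd⟩, hblocks⟩ := hblocks
    obtain ⟨A, M, q, hq, hA, hM, hAl, hMl, hb⟩ := exists_adder as ys c hlen hnd
    have hqX : q ∈ X := by
      rcases List.mem_cons.1 hq with rfl | h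
      exacts [hc, hasX q h]
    -- By the adder identity, the value of `ys` plus this addend is the new value of `ys` plus a
    -- multiple of the overflow bit. The first part is the remaining accumulation after `A`, the
    -- second a single-bit phase after `M`; conjugation costs `2 * 6 + 2 * 3 = 18` gates per bit.
    refine (((ih hblocks).conj hA (a := 6 * ys.length) (by omega)).add
      (((hbit q hqX).conj hM (a := 3 * ys.length) (by omega)).const_mul
        (2 ^ as.length))).congr (fun b => ?_) (by rw [List.length_cons]; linarith)
    obtain ⟨h₁, h₂, h₃⟩ := hb b
    have hgA : g (A.act b) = g b := hg fun r hr => h₁ r fun h => hr (hys r h)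
    have hgM : g (M.act b) = g b := hg fun r hr => h₂ r fun h => hr <| by
      rcases List.mem_cons.1 h with rfl | h
      · exact hc
      · rcases List.mem_append.1 h with h | h
        exacts [hasX r h, hys r h]
    have hnot : ∀ as', (c :: (as' ++ ys)).Nodup → bit c (A.act b) = bit c b ∧
        val as' (A.act b) = val as' b := by
      intro as' h'
      have hc' := (List.nodup_cons.1 h').1
      have hd := List.disjoint_of_nodup_append (List.nodup_cons.1 h').2
      exact ⟨by rw [bit, bit, h₁ c fun h => hc' (List.mem_append_right _ h)],
        val_congr fun r hr => h₁ r fun h => hd hr h⟩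
    have hrest : (blocks.map fun as => (val as (A.act b) + bit c (A.act b) : ℚ)) =
        blocks.map fun as => (val as b + bit c b : ℚ) := by
      refine List.map_congr_left fun as' h' => ?_
      rw [(hnot as' (hblocks as' h').2.2).1, (hnot as' (hblocks as' h').2.2).2]
    have h₃' : (val ys (A.act b) + 2 ^ as.length * bit q (M.act b) : ℚ) =
        val ys b + val as b + bit c b := by exact_mod_cast h₃
    rw [hgA, hgM, hrest, List.map_cons, List.sum_cons]
    linear_combination -g b * h₃'

end Adder

/-! ### Evaluation and interpolation -/

/-- A product of two polynomials with `k` coefficients each, evaluated at `B`, is a fixed linear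
combination of its values at `0, …, 2k-2`. -/
theorem exists_interpolation (k : ℕ) (hk : 1 ≤ k) (B : ℚ) : ∃ coef : ℕ → ℚ, ∀ u v : ℕ → ℚ,
    (∑ i ∈ Finset.range k, B ^ i * u i) * (∑ i ∈ Finset.range k, B ^ i * v i) =
      ∑ l ∈ Finset.range (2 * k - 1), coef l *
        ((∑ i ∈ Finset.range k, (l : ℚ) ^ i * u i) *
          (∑ i ∈ Finset.range k, (l : ℚ) ^ i * v i)) := by
  have hinj : Set.InjOn (fun i : ℕ => (i : ℚ)) (Finset.range (2 * k - 1)) :=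
    fun _ _ _ _ h => Nat.cast_injective h
  refine ⟨fun l => (Lagrange.basis (Finset.range (2 * k - 1)) (fun i : ℕ => (i : ℚ)) l).eval B,
    fun u v => ?_⟩
  let p : (ℕ → ℚ) → Polynomial ℚ := fun u =>
    ∑ i ∈ Finset.range k, Polynomial.C (u i) * Polynomial.X ^ i
  have heval : ∀ (u : ℕ → ℚ) (x : ℚ), (p u).eval x = ∑ i ∈ Finset.range k, x ^ i * u i := by
    intro u x
    simp only [p, Polynomial.eval_finsetSum, Polynomial.eval_mul, Polynomial.eval_C,
      Polynomial.eval_pow, Polynomial.eval_X]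
    exact Finset.sum_congr rfl fun i _ => mul_comm _ _
  have hdeg : ∀ u : ℕ → ℚ, (p u).natDegree ≤ k - 1 := by
    intro u
    refine Polynomial.natDegree_sum_le_of_forall_le _ _ fun i hi => ?_
    have := Finset.mem_range.1 hi
    exact (Polynomial.natDegree_C_mul_X_pow_le _ _).trans (by omega)
  have hlt : (p u * p v).degree < (Finset.range (2 * k - 1)).card := by
    refine lt_of_le_of_lt Polynomial.degree_le_natDegree ?_
    rw [Finset.card_range]
    have h₁ := Polynomial.natDegree_mul_le (p := p u) (q := p v)
    have h₂ := hdeg u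
    have h₃ := hdeg v
    exact_mod_cast (by omega : (p u * p v).natDegree < 2 * k - 1)
  have h := congrArg (Polynomial.eval B) (Lagrange.eq_interpolate hinj hlt)
  rw [Lagrange.interpolate_apply, Polynomial.eval_finsetSum, Polynomial.eval_mul, heval, heval] at h
  rw [h]
  refine Finset.sum_congr rfl fun l _ => ?_
  rw [Polynomial.eval_mul, Polynomial.eval_C, Polynomial.eval_mul, heval, heval, mul_comm]

/-! ### Blocks of a register and in-place evaluation of their polynomial -/

section Blocks

variable {Q : Type}

/-- The `i`-th block of `s` qubits of a register. -/
def block (s : ℕ) (xs : List Q) (i : ℕ) : List Q := (xs.drop (i * s)).take s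

theorem length_block_le (s : ℕ) (xs : List Q) (i : ℕ) : (block s xs i).length ≤ s :=
  List.length_take_le _ _

theorem length_block_le_zero (s : ℕ) (xs : List Q) (i : ℕ) :
    (block s xs i).length ≤ (block s xs 0).length := by
  simp only [block, List.length_take, List.length_drop]; omega

theorem block_subset (s : ℕ) (xs : List Q) (i : ℕ) : ∀ q ∈ block s xs i, q ∈ xs :=
  fun _ h => List.mem_of_mem_drop (List.mem_of_mem_take h)

theorem nodup_block {c : Q} {xs : List Q} (h : (c :: xs).Nodup) (s i : ℕ) :
    (c :: (block s xs (i + 1) ++ block s xs 0)).Nodup := by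
  have hsub : (block s xs (i + 1)).Sublist (xs.drop s) := by
    have : xs.drop ((i + 1) * s) = (xs.drop s).drop (i * s) := by
      rw [List.drop_drop]; congr 1; ring
    rw [block, this]
    exact (List.take_sublist _ _).trans (List.drop_sublist _ _)
  have h₀ : block s xs 0 = xs.take s := by simp [block]
  have hp : (block s xs 0 ++ block s xs (i + 1)).Sublist xs := by
    conv_rhs => rw [← List.take_append_drop s xs]
    rw [h₀]
    exact (List.Sublist.refl _).append hsub
  exact ((List.perm_append_comm.cons c).nodup_iff).1 (h.sublist (hp.cons_cons c))

theorem val_take_mul (s k : ℕ) (xs : List Q) (b : Q → Bool) :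
    (val (xs.take (k * s)) b : ℚ) =
      ∑ i ∈ Finset.range k, ((2 : ℚ) ^ s) ^ i * val (block s xs i) b := by
  induction k with
  | zero => simp [val]
  | succ k ih =>
    rw [Finset.sum_range_succ, ← ih, add_mul, one_mul, List.take_add, val_append]
    push_cast
    congr 1
    by_cases h : k * s ≤ xs.length
    · rw [List.length_take_of_le h, block, ← pow_mul, mul_comm s k]
    · have : xs.drop (k * s) = [] := List.drop_eq_nil_of_le (by omega)
      simp [block, this, val]

/-- Multiplication by `l ^ (i + 1)` is repeated addition. The number of additions depends only on
`l` and `k`, not on the register size. -/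
theorem exists_addends (s l k : ℕ) (c : Q) (xs : List Q) : ∃ blocks : List (List Q),
    (∀ as ∈ blocks, ∃ i, as = block s xs (i + 1)) ∧
    blocks.length = ∑ i ∈ Finset.range k, l ^ (i + 1) ∧
    ∀ b, (blocks.map fun as => (val as b + bit c b : ℚ)).sum =
      ∑ i ∈ Finset.range k, (l : ℚ) ^ (i + 1) * (val (block s xs (i + 1)) b + bit c b) := by
  induction k with
  | zero => exact ⟨[], by simp⟩
  | succ k ih =>
    obtain ⟨blocks, h₁, h₂, h₃⟩ := ih
    refine ⟨blocks ++ List.replicate (l ^ (k + 1)) (block s xs (k + 1)), fun as h => ?_, ?_,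
      fun b => ?_⟩
    · rcases List.mem_append.1 h with h | h
      exacts [h₁ as h, ⟨k, List.eq_of_mem_replicate h⟩]
    · rw [List.length_append, h₂, List.length_replicate, Finset.sum_range_succ]
    · rw [List.map_append, List.sum_append, h₃, Finset.sum_range_succ]
      simp [mul_add]

/-- The sum of the registers `blocks`, each increased by the bit `c`, can be accumulated in the
register `ys`; all qubits involved are in `X`. -/
structure Accumulation (X : Set Q) (c : Q) (ys : List Q) (blocks : List (List Q)) : Prop where
  mem : c ∈ X
  subset : ∀ q ∈ ys, q ∈ X
  blocks : ∀ as ∈ blocks, (∀ q ∈ as, q ∈ X) ∧ as.length ≤ ys.length ∧ (c :: (as ++ ys)).Nodup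

/-- The value of an accumulation. -/
def accumulated (c : Q) (ys : List Q) (blocks : List (List Q)) (b : Q → Bool) : ℚ :=
  val ys b + (blocks.map fun as => (val as b + bit c b : ℚ)).sum

theorem Accumulation.dependsOn {X : Set Q} {c : Q} {ys : List Q} {blocks : List (List Q)}
    (h : Accumulation X c ys blocks) : DependsOn (accumulated c ys blocks) X := by
  intro b b' hb
  have h₁ : val ys b = val ys b' := val_congr fun q hq => hb q (h.subset q hq)
  have h₂ : bit c b = bit c b' := by rw [bit, bit, hb c h.mem]
  rw [accumulated, accumulated, h₁, h₂]
  congr 2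
  refine List.map_congr_left fun as has => ?_
  rw [val_congr fun q hq => hb q ((h.blocks as has).1 q hq)]

/-- The value of the polynomial whose coefficients are the blocks of a register is accumulated in
the lowest block, up to a multiple of the bit `c`. -/
theorem exists_accumulation {c : Q} {xs : List Q} (hnd : (c :: xs).Nodup) (s l k : ℕ) :
    ∃ blocks, Accumulation {q | q ∈ c :: xs} c (block s xs 0) blocks ∧
      blocks.length = ∑ i ∈ Finset.range k, l ^ (i + 1) ∧
      ∀ b, ∑ i ∈ Finset.range (k + 1), (l : ℚ) ^ i * val (block s xs i) b =
        accumulated c (block s xs 0) blocks b - blocks.length * bit c b := by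
  obtain ⟨blocks, h₁, h₂, h₃⟩ := exists_addends s l k c xs
  refine ⟨blocks, ⟨by simp, fun q hq => List.mem_cons_of_mem _ (block_subset _ _ _ q hq),
    fun as has => ?_⟩, h₂, fun b => ?_⟩
  · obtain ⟨i, rfl⟩ := h₁ as has
    exact ⟨fun q hq => List.mem_cons_of_mem _ (block_subset _ _ _ q hq),
      length_block_le_zero _ _ _, nodup_block hnd _ _⟩
  · rw [accumulated, h₃, h₂, Finset.sum_range_succ']
    simp only [mul_add, Finset.sum_add_distrib, ← Finset.sum_mul]
    push_cast
    ring

end Blocks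

/-! ### Fast multiplication -/

section Toom

variable {Q : Type} [DecidableEq Q]

variable {X X' : Set Q} {c c' : Q} {ys ys' : List Q} {blocks blocks' : List (List Q)} {L W : ℕ}

theorem Accumulation.bit_mul (h : Accumulation X c ys blocks) (hL : ys.length ≤ L)
    (hW : blocks.length ≤ W) {q : Q} (hq : q ∉ X) :
    HasPhaseCircuit (fun b => bit q b * accumulated c ys blocks b) (L + W * (1 + 18 * L)) := by
  have hg : DependsOn (fun b : Q → Bool => (bit q b : ℚ)) Xᶜ := fun b b' hb => by
    simp only [bit, hb q hq]
  refine (HasPhaseCircuit.accumulate hg h.mem h.subset (m := 1) (n := ys.length)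
    (fun p hp => HasPhaseCircuit.bit_mul_bit (ne_of_mem_of_not_mem hp hq))
    ((HasPhaseCircuit.bit_mul_val fun hy => hq (h.subset q hy)).congr (fun _ => mul_comm _ _) le_rfl)
    blocks h.blocks).congr (fun b => mul_comm _ _) ?_
  gcongr

/-- One factor is accumulated at a time. Every overflow correction is a bit times a register or an
accumulated value, so the product of the two lowest blocks, of cost `t`, is needed only once. -/
theorem Accumulation.mul (h : Accumulation X c ys blocks) (h' : Accumulation X' c' ys' blocks')
    (hX : Disjoint X X') (hL : ys.length ≤ L) (hL' : ys'.length ≤ L) (hW : blocks.length ≤ W)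
    (hW' : blocks'.length ≤ W) {t : ℕ}
    (ht : HasPhaseCircuit (fun b => (val ys b * val ys' b : ℚ)) t) :
    HasPhaseCircuit (fun b => accumulated c ys blocks b * accumulated c' ys' blocks' b)
      (t + W * (L + 18 * L) + W * (L + W * (1 + 18 * L) + 18 * L)) := by
  have hg : DependsOn (fun b : Q → Bool => (val ys b : ℚ)) X'ᶜ := fun b b' hb => by
    simp only [Nat.cast_inj]
    exact val_congr fun q hq => hb q fun hq' => Set.disjoint_left.1 hX (h.subset q hq) hq'
  have h₁ : HasPhaseCircuit (fun b => val ys b * accumulated c' ys' blocks' b)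
      (t + W * (L + 18 * L)) := by
    refine (HasPhaseCircuit.accumulate hg h'.mem h'.subset (m := ys.length) (n := t)
      (fun p hp => HasPhaseCircuit.bit_mul_val fun hy =>
        Set.disjoint_left.1 hX (h.subset p hy) hp)
      (ht.congr (fun _ => mul_comm _ _) le_rfl)
      blocks' h'.blocks).congr (fun b => mul_comm _ _) ?_
    gcongr
  have hg' : DependsOn (accumulated c' ys' blocks') Xᶜ := fun b b' hb =>
    h'.dependsOn fun q hq => hb q fun hq' => Set.disjoint_left.1 hX hq' hq
  refine (HasPhaseCircuit.accumulate hg' h.mem h.subset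
    (fun p hp => h'.bit_mul hL' hW' (Set.disjoint_left.1 hX hp)) h₁ blocks h.blocks).congr
    (fun b => rfl) ?_
  gcongr

/-- The number of gates, up to a factor, for evaluating and multiplying at one point. -/
def pointCost (W : ℕ) : ℕ := 19 * W ^ 2 + 76 * W + 3

theorem phase_at_point {c c' : Q} {xs zs : List Q} (hx : (c :: xs).Nodup) (hz : (c' :: zs).Nodup)
    (hd : (c :: xs).Disjoint (c' :: zs)) (s l k N t : ℕ) (hsN : s ≤ N) (hN : 1 ≤ N)
    (ht : HasPhaseCircuit (fun b => (val (block s xs 0) b * val (block s zs 0) b : ℚ)) t) :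
    HasPhaseCircuit (fun b => (∑ i ∈ Finset.range (k + 1), (l : ℚ) ^ i * val (block s xs i) b) *
        ∑ i ∈ Finset.range (k + 1), (l : ℚ) ^ i * val (block s zs i) b)
      (t + pointCost (∑ i ∈ Finset.range k, l ^ (i + 1)) * N) := by
  obtain ⟨bx, hbx, hbxl, hxs⟩ := exists_accumulation hx s l k
  obtain ⟨bz, hbz, hbzl, hzs⟩ := exists_accumulation hz s l k
  generalize (∑ i ∈ Finset.range k, l ^ (i + 1)) = W at *
  have hX : Disjoint {q | q ∈ c :: xs} {q | q ∈ c' :: zs} :=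
    Set.disjoint_left.2 fun q h h' => hd h h'
  have h₁ := (length_block_le s xs 0).trans hsN
  have h₂ := (length_block_le s zs 0).trans hsN
  have hcc : c ≠ c' := fun h => hd (a := c) (by simp) (by simp [h])
  have hPQ := hbx.mul hbz hX h₁ h₂ hbxl.le hbzl.le ht
  have hcQ := (hbz.bit_mul h₂ hbzl.le
    (Set.disjoint_left.1 hX (show c ∈ c :: xs by simp))).const_mul (-(W : ℚ))
  have hcP := (hbx.bit_mul h₁ hbxl.le
    (Set.disjoint_right.1 hX (show c' ∈ c' :: zs by simp))).const_mul (-(W : ℚ))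
  have hbits := (HasPhaseCircuit.bit_mul_bit hcc).const_mul ((W : ℚ) ^ 2)
  refine (((hPQ.add hcQ).add hcP).add hbits).congr (fun b => ?_) ?_
  -- With `P`, `Q` the accumulated values, `(P - W c)(Q - W c') = P Q - W c Q - W c' P + W² c c'`.
  · rw [hxs, hzs, hbxl, hbzl]; ring
  · simp only [pointCost]
    nlinarith [Nat.zero_le W, Nat.mul_le_mul_left W hN, Nat.mul_le_mul_left (W ^ 2) hN]

/-- The number of gates per qubit used by one level of the recursion. -/
def levelCost (k : ℕ) : ℕ :=
  (2 * k - 1) * pointCost (∑ i ∈ Finset.range (k - 1), (2 * k) ^ (i + 1)) + 2 * k + 2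

/-- One Toom-Cook level. The lowest qubit of each register is set aside as carry-in and `k` blocks
of `N / k` bits are taken from the rest; all else is multiplied directly in `O(N)` gates. -/
theorem recursion_step {k : ℕ} (hk : 2 ≤ k) (N t : ℕ)
    (ht : ∀ xs zs : List Q, xs.Nodup → zs.Nodup → xs.Disjoint zs → xs.length ≤ N / k →
      zs.length ≤ N / k → HasPhaseCircuit (fun b => (val xs b * val zs b : ℚ)) t)
    (xs zs : List Q) (hx : xs.Nodup) (hz : zs.Nodup) (hd : xs.Disjoint zs)
    (hxN : xs.length ≤ N) (hzN : zs.length ≤ N) :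
    HasPhaseCircuit (fun b => (val xs b * val zs b : ℚ))
      ((2 * k - 1) * t + levelCost k * N) := by
  obtain _ | ⟨c, xs⟩ := xs
  · exact HasPhaseCircuit.zero.congr (by simp [val]) (by simp)
  obtain _ | ⟨c', zs⟩ := zs
  · exact HasPhaseCircuit.zero.congr (by simp [val]) (by simp)
  rw [List.length_cons] at hxN hzN
  set s := N / k with hs
  have hks : N < k * s + k := by rw [hs]; exact Nat.lt_mul_div_succ N (by omega)
  have hsN : s ≤ N := Nat.div_le_self _ _
  have hxn := (List.nodup_cons.1 hx).2
  have hzn := (List.nodup_cons.1 hz).2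
  have hblocks : HasPhaseCircuit
      (fun b => (val (block s xs 0) b * val (block s zs 0) b : ℚ)) t :=
    ht _ _ (hxn.sublist ((List.take_sublist _ _).trans (List.drop_sublist _ _)))
      (hzn.sublist ((List.take_sublist _ _).trans (List.drop_sublist _ _)))
      (fun q h h' => hd (List.mem_cons_of_mem _ (block_subset _ _ _ q h))
        (List.mem_cons_of_mem _ (block_subset _ _ _ q h')))
      (length_block_le _ _ _) (length_block_le _ _ _)
  obtain ⟨coef, hcoef⟩ := exists_interpolation k (by omega) ((2 : ℚ) ^ s)
  set V := pointCost (∑ i ∈ Finset.range (k - 1), (2 * k) ^ (i + 1)) with hV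
  have hmain : HasPhaseCircuit
      (fun b => (val (xs.take (k * s)) b * val (zs.take (k * s)) b : ℚ))
      ((2 * k - 1) * (t + V * N)) := by
    refine (HasPhaseCircuit.sum_range (2 * k - 1) (f := fun l b => coef l *
      ((∑ i ∈ Finset.range k, (l : ℚ) ^ i * val (block s xs i) b) *
        ∑ i ∈ Finset.range k, (l : ℚ) ^ i * val (block s zs i) b)) fun l hl => ?_).congr
      (fun b => ?_) le_rfl
    · refine ((phase_at_point hx hz hd s l (k - 1) N t hsN (by omega) hblocks).const_mul
        (coef l)).congr (fun b => ?_) ?_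
      · rw [Nat.sub_add_cancel (by omega)]
      -- The points satisfy `l ≤ 2k - 2`, so `2 * k` bounds them uniformly.
      · rw [hV]
        simp only [pointCost]
        gcongr <;> omega
    · rw [val_take_mul, val_take_mul, hcoef]
  have hdx : ∀ q, q ∈ xs → q ∉ zs := fun q h h' =>
    hd (List.mem_cons_of_mem _ h) (List.mem_cons_of_mem _ h')
  -- Fewer than `k` bits lie beyond the blocks, because `N < k * s + k`.
  have h₁ : HasPhaseCircuit (fun b => (val (xs.drop (k * s)) b * val zs b : ℚ)) (k * N) := by
    refine (HasPhaseCircuit.val_mul_val fun q h h' => hdx q (List.mem_of_mem_drop h) h').congr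
      (fun _ => rfl) ?_
    rw [List.length_drop]
    exact Nat.mul_le_mul (by omega) (by omega)
  have h₂ : HasPhaseCircuit
      (fun b => (val (zs.drop (k * s)) b * val (xs.take (k * s)) b : ℚ)) (k * N) := by
    refine (HasPhaseCircuit.val_mul_val fun q h h' => hdx q (List.mem_of_mem_take h')
      (List.mem_of_mem_drop h)).congr (fun _ => rfl) ?_
    rw [List.length_drop]
    exact Nat.mul_le_mul (by omega) ((List.length_take_le' _ _).trans (by omega))
  have h₃ : HasPhaseCircuit (fun b => (bit c b * val (c' :: zs) b : ℚ)) N :=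
    (HasPhaseCircuit.bit_mul_val fun h => hd (a := c) (by simp) h).congr (fun _ => rfl) hzN
  have h₄ : HasPhaseCircuit (fun b => (bit c' b * val xs b : ℚ)) N :=
    (HasPhaseCircuit.bit_mul_val fun h => hd (List.mem_cons_of_mem _ h)
      (List.mem_cons_self)).congr (fun _ => rfl) (by omega)
  have hsplit : ∀ (xs : List Q) (b : Q → Bool), (val xs b : ℚ) =
      val (xs.take (k * s)) b + 2 ^ (k * s) * val (xs.drop (k * s)) b := by
    intro xs b
    conv_lhs => rw [← List.take_append_drop (k * s) xs, val_append]
    by_cases h : k * s ≤ xs.length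
    · rw [List.length_take_of_le h]; push_cast; rfl
    · have : xs.drop (k * s) = [] := List.drop_eq_nil_of_le (by omega)
      simp [this, val]
  -- Expansion of `(c + 2x)(c' + 2z)` as `4xz + c(c' + 2z) + 2c'x`, with `x` and `z` split at bit `k
  -- * s`.
  refine ((((hmain.const_mul 4).add (h₁.const_mul (4 * 2 ^ (k * s)))).add
    (h₂.const_mul (4 * 2 ^ (k * s)))).add (h₃.add (h₄.const_mul 2))).congr (fun b => ?_) ?_
  · have e₁ := hsplit xs b
    have e₂ := hsplit zs b
    simp only [val]
    push_cast
    rw [e₁, e₂]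
    ring
  · rw [levelCost, ← hV]
    exact le_of_eq (by ring)

end Toom

/-! ### Gate count of multiplication -/

theorem one_lt_logb_two_mul_sub_one {k : ℕ} (hk : 2 ≤ k) : 1 < Real.logb k (2 * k - 1) := by
  have hk' : (2 : ℝ) ≤ k := by exact_mod_cast hk
  rw [Real.lt_logb_iff_rpow_lt (by linarith) (by linarith), Real.rpow_one]
  linarith

theorem exists_phase_bound {k : ℕ} (hk : 2 ≤ k) : ∃ K : ℝ, 0 ≤ K ∧ ∀ (Q : Type) [DecidableEq Q],
    ∀ N : ℕ, ∃ t : ℕ, (t : ℝ) ≤ K * (N : ℝ) ^ Real.logb k (2 * k - 1) ∧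
      ∀ xs zs : List Q, xs.Nodup → zs.Nodup → xs.Disjoint zs → xs.length ≤ N → zs.length ≤ N →
        HasPhaseCircuit (fun b => (val xs b * val zs b : ℚ)) t := by
  have hk' : (2 : ℝ) ≤ k := by exact_mod_cast hk
  set α := Real.logb k (2 * k - 1) with hα
  have hα₁ : 1 < α := one_lt_logb_two_mul_sub_one hk
  have hkα : (k : ℝ) ^ α = 2 * k - 1 :=
    Real.rpow_logb (by linarith) (by linarith) (by linarith)
  set c : ℝ := (levelCost k : ℝ)
  have hc : 0 ≤ c := Nat.cast_nonneg _
  refine ⟨4 * c + 8 * k, by positivity, fun Q _ N => ?_⟩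
  -- The subtracted linear term makes the induction close: it grows by at least a factor `5 / 4` at
  -- each level, which absorbs the cost `c * N`.
  suffices h : ∃ t : ℕ, (t : ℝ) ≤ (4 * c + 8 * k) * (N : ℝ) ^ α - 4 * c * N ∧
      ∀ xs zs : List Q, xs.Nodup → zs.Nodup → xs.Disjoint zs → xs.length ≤ N → zs.length ≤ N →
        HasPhaseCircuit (fun b => (val xs b * val zs b : ℚ)) t by
    obtain ⟨t, h₁, h₂⟩ := h
    exact ⟨t, h₁.trans (sub_le_self _ (by positivity)), h₂⟩
  induction N using Nat.strong_induction_on with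
  | _ N ih =>
  -- From `8 * k` on, rounding `N / k` down is harmless: `(2k-1)⌊N/k⌋ ≥ (3/2)(7/8) N ≥ (5/4) N`.
  rcases lt_or_ge N (8 * k) with hN | hN
  · refine ⟨N * N, ?_, fun xs zs _ _ hd h₁ h₂ =>
      (HasPhaseCircuit.val_mul_val hd).congr (fun _ => rfl) (Nat.mul_le_mul h₁ h₂)⟩
    rcases Nat.eq_zero_or_pos N with rfl | hpos
    · simp [Real.zero_rpow (by linarith : α ≠ 0)]
    · have h₁ : (1 : ℝ) ≤ N := by exact_mod_cast hpos
      have h₂ : (N : ℝ) ≤ (N : ℝ) ^ α := Real.self_le_rpow_of_one_le h₁ hα₁.le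
      have h₃ : (N : ℝ) ≤ 8 * k := by exact_mod_cast hN.le
      have h₄ : (4 * c + 8 * k) * (N : ℝ) ≤ (4 * c + 8 * k) * (N : ℝ) ^ α := by gcongr
      have h₅ : (N : ℝ) * N ≤ 8 * k * N := by gcongr
      push_cast
      linarith
  · obtain ⟨t, ht, h⟩ := ih (N / k) (Nat.div_lt_self (by omega) (by omega))
    refine ⟨(2 * k - 1) * t + levelCost k * N, ?_, recursion_step hk N t h⟩
    have hfloor : (N : ℝ) < k * ((N / k : ℕ) : ℝ) + k := by
      exact_mod_cast Nat.lt_mul_div_succ N (by omega : 0 < k)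
    have hN' : (8 : ℝ) * k ≤ N := by exact_mod_cast hN
    have hpow : (2 * k - 1 : ℝ) * ((N / k : ℕ) : ℝ) ^ α ≤ (N : ℝ) ^ α := by
      rw [← hkα, ← Real.mul_rpow (by positivity) (by positivity)]
      refine Real.rpow_le_rpow (by positivity) ?_ (by linarith)
      exact_mod_cast Nat.mul_div_le N k
    have hcast : ((2 * k - 1 : ℕ) : ℝ) = 2 * k - 1 := by
      rw [Nat.cast_sub (by omega)]; push_cast; rfl
    have h₁ : (2 * k - 1 : ℝ) * t ≤ (2 * k - 1 : ℝ) *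
        ((4 * c + 8 * k) * ((N / k : ℕ) : ℝ) ^ α - 4 * c * ((N / k : ℕ) : ℝ)) :=
      mul_le_mul_of_nonneg_left ht (by linarith)
    have h₂ : (4 * c + 8 * k) * ((2 * k - 1 : ℝ) * ((N / k : ℕ) : ℝ) ^ α) ≤
        (4 * c + 8 * k) * (N : ℝ) ^ α := by gcongr
    have h₃ : 5 / 4 * (N : ℝ) ≤ (2 * k - 1) * ((N / k : ℕ) : ℝ) := by
      have : (0 : ℝ) ≤ ((N / k : ℕ) : ℝ) := Nat.cast_nonneg _
      nlinarith
    have h₄ : 4 * c * (5 / 4 * (N : ℝ)) ≤ 4 * c * ((2 * k - 1) * ((N / k : ℕ) : ℝ)) := by gcongr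
    push_cast
    rw [hcast]
    change _ + c * N ≤ _
    linarith

/-! ### From phase circuits to the phase product operator -/

/-- Phase circuits as operators. -/
theorem HasPhaseCircuit.exists_circuit {Q : Type} [Fintype Q] [DecidableEq Q]
    {f : (Q → Bool) → ℚ} {n : ℕ} (h : HasPhaseCircuit f n) : ∃ T : Circuit ℚ Q,
      T.HadamardFree ∧ T.length ≤ n ∧ ∀ φ : ℝ, (T.scale φ).op =
        Matrix.diagonal fun b => Complex.exp (Complex.I * φ * (f b : ℚ)) := by
  obtain ⟨T, h₁, h₂, h₃⟩ := h
  refine ⟨T, h₁, h₂, fun φ => ?_⟩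
  rw [Circuit.op_scale h₁]
  ext b' b
  rw [Matrix.of_apply, Matrix.diagonal_apply, (h₃ b).1, (h₃ b).2]
  by_cases hb : b' = b
  · rw [if_pos hb, if_pos hb, hb]
  · rw [if_neg hb, if_neg hb]

theorem Circuit.length_scale {Q : Type} (φ : ℝ) (T : Circuit ℚ Q) :
    (T.scale φ).length = T.length := List.length_map _

theorem val_ofFn {Q : Type} {n : ℕ} (f : Fin n → Q) (b : Q → Bool) :
    val (List.ofFn f) b = Nat.ofBits fun i => b (f i) := by
  induction n with
  | zero => simp [val]
  | succ n ih =>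
    rw [List.ofFn_succ, val, ih, Nat.ofBits_succ, bit, add_comm]
    rfl

/-- The qubits of the first register. -/
def fstList (n m : ℕ) : List (Fin n ⊕ Fin m) := List.ofFn Sum.inl

/-- The qubits of the second register. -/
def sndList (n m : ℕ) : List (Fin n ⊕ Fin m) := List.ofFn Sum.inr

theorem val_fstList {n m : ℕ} (b : Fin n ⊕ Fin m → Bool) : val (fstList n m) b = fstVal b :=
  val_ofFn _ _

theorem val_sndList {n m : ℕ} (b : Fin n ⊕ Fin m → Bool) : val (sndList n m) b = sndVal b :=
  val_ofFn _ _

theorem nodup_fstList (n m : ℕ) : (fstList n m).Nodup :=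
  List.nodup_ofFn.2 Sum.inl_injective

theorem nodup_sndList (n m : ℕ) : (sndList n m).Nodup :=
  List.nodup_ofFn.2 Sum.inr_injective

theorem disjoint_fstList_sndList (n m : ℕ) : (fstList n m).Disjoint (sndList n m) := by
  intro q h h'
  simp only [fstList, sndList, List.mem_ofFn] at h h'
  obtain ⟨i, rfl⟩ := h
  obtain ⟨j, hj⟩ := h'
  cases hj

theorem exists_phaseProduct_circuit {k : ℕ} (hk : 2 ≤ k) : ∃ K : ℝ, ∀ n m : ℕ,
    ∃ T : Circuit ℚ (Fin n ⊕ Fin m), T.HadamardFree ∧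
      (T.length : ℝ) ≤ K * ((max n m : ℕ) : ℝ) ^ Real.logb k (2 * k - 1) ∧
      ∀ φ : ℝ, (T.scale φ).op = phaseProduct n m φ := by
  obtain ⟨K, -, hK⟩ := exists_phase_bound hk
  refine ⟨K, fun n m => ?_⟩
  obtain ⟨t, ht, h⟩ := hK (Fin n ⊕ Fin m) (max n m)
  obtain ⟨T, h₁, h₂, h₃⟩ := (h _ _ (nodup_fstList n m) (nodup_sndList n m)
    (disjoint_fstList_sndList n m) (by simp [fstList]) (by simp [sndList])).exists_circuit
  refine ⟨T, h₁, le_trans (by exact_mod_cast h₂) ht, fun φ => ?_⟩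
  rw [h₃, phaseProduct]
  congr 1
  funext b
  rw [val_fstList, val_sndList]
  push_cast
  rw [mul_assoc _ (fstVal b : ℂ)]

/-! ### The quantum Fourier transform -/

section Fourier

variable {Q : Type} [Fintype Q] [DecidableEq Q]

theorem Circuit.op_append (C D : Circuit ℝ Q) :
    Circuit.op (C ++ D) = Circuit.op D * Circuit.op C := by
  induction C with
  | nil => simp [Circuit.op]
  | cons g C ih => simp [Circuit.op, ih, Matrix.mul_assoc]

/-- The inverse of a gate. -/
noncomputable def Gate.inv : Gate ℝ Q → Gate ℝ Q
  | .R θ t => .R (-θ) t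
  | .CR θ c t h => .CR (-θ) c t h
  | g => g

theorem basisMap_mul_self {f : (Q → Bool) → (Q → Bool)} (hf : Function.Involutive f) :
    basisMap f * basisMap f = 1 := by
  ext b' b
  rw [Matrix.mul_apply, Finset.sum_eq_single (f b)]
  · simp [basisMap, Matrix.one_apply, hf b]
  · intro c _ hc
    simp [basisMap, hc]
  · simp

theorem Gate.op_H_mul_self (t : Q) : (Gate.H t).op * (Gate.H t).op = 1 := by
  have h2 : (Real.sqrt 2 : ℂ)⁻¹ * (Real.sqrt 2 : ℂ)⁻¹ = 1 / 2 := by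
    rw [← mul_inv, ← Complex.ofReal_mul, Real.mul_self_sqrt (by norm_num)]
    norm_num
  ext b' b
  have hne : b ≠ Function.update b t (!b t) := fun h => by
    have := congrFun h t
    simp at this
  rw [Matrix.mul_apply, Finset.sum_eq_add b (Function.update b t (!b t)) hne]
  · by_cases h : ∀ s, s ≠ t → b' s = b s
    · have h' : ∀ s, s ≠ t → b' s = Function.update b t (!b t) s := fun s hs => by
        rw [Function.update_of_ne hs, h s hs]
      have h'' : ∀ s, s ≠ t → Function.update b t (!b t) s = b s := fun s hs => by
        rw [Function.update_of_ne hs]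
      have heq : b' = b ↔ b' t = b t := by
        refine ⟨fun e => by rw [e], fun e => funext fun s => ?_⟩
        by_cases hs : s = t
        · rw [hs, e]
        · exact h s hs
      simp only [Gate.op, Matrix.of_apply, if_pos h, if_pos h', if_pos h'', Matrix.one_apply, heq,
        implies_true, if_true, Function.update_self, div_eq_mul_inv]
      generalize (Real.sqrt 2 : ℂ)⁻¹ = r at h2
      cases b t <;> cases b' t <;> simp <;> linear_combination 2 * h2
    · have h' : ¬ ∀ s, s ≠ t → b' s = Function.update b t (!b t) s := fun h' => h fun s hs => by
        rw [h' s hs, Function.update_of_ne hs]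
      have hb : b' ≠ b := fun e => h fun s _ => by rw [e]
      simp [Gate.op, h, h', hb]
  · rintro c - ⟨h₁, h₂⟩
    have : ¬ ∀ s, s ≠ t → c s = b s := by
      intro hc
      by_cases hct : c t = b t
      · exact h₁ (funext fun s => if hs : s = t then by rw [hs, hct] else hc s hs)
      · refine h₂ (funext fun s => ?_)
        by_cases hs : s = t
        · rw [hs, Function.update_self]
          cases h : c t <;> cases h' : b t <;> simp_all
        · rw [Function.update_of_ne hs, hc s hs]
    simp only [Gate.op, Matrix.of_apply, if_neg this, mul_zero]
  · simp
  · simp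

theorem Gate.op_inv_mul (g : Gate ℝ Q) : g.inv.op * g.op = 1 := by
  cases g with
  | X t => exact basisMap_mul_self fun b => by simp
  | CNOT c t h => exact basisMap_mul_self fun b => by simp [Function.update_of_ne h]
  | toffoli c₁ c₂ t h₁₂ h₁ h₂ =>
    exact basisMap_mul_self fun b => by simp [Function.update_of_ne h₁, Function.update_of_ne h₂]
  | H t => exact Gate.op_H_mul_self t
  | R θ t =>
    simp only [Gate.inv, Gate.op, Matrix.diagonal_mul_diagonal]
    rw [← Matrix.diagonal_one]
    congr 1; funext b
    cases b t <;> simp [← Complex.exp_add]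
  | CR θ c t h =>
    simp only [Gate.inv, Gate.op, Matrix.diagonal_mul_diagonal]
    rw [← Matrix.diagonal_one]
    congr 1; funext b
    cases b c <;> cases b t <;> simp [← Complex.exp_add]

/-- The inverse of a circuit. -/
noncomputable def Circuit.inv (C : Circuit ℝ Q) : Circuit ℝ Q := (C.map Gate.inv).reverse

theorem Circuit.op_inv_mul (C : Circuit ℝ Q) : C.inv.op * C.op = 1 := by
  induction C with
  | nil => simp [Circuit.inv, Circuit.op]
  | cons g C ih =>
    have h : Circuit.inv (g :: C) = Circuit.inv C ++ [g.inv] := by simp [Circuit.inv]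
    rw [h, Circuit.op_append]
    simp only [Circuit.op, one_mul]
    rw [Matrix.mul_assoc, ← Matrix.mul_assoc _ (Circuit.op C), ih, Matrix.one_mul,
      Gate.op_inv_mul]

/-- The quantum Fourier transform of the register `ws`, with output in reversed bit order. -/
noncomputable def fourier (ws : List Q) : Op Q := Matrix.of fun b' b =>
  if ∀ q, q ∉ ws → b' q = b q then
    (1 / (Real.sqrt 2 : ℂ)) ^ ws.length *
      Complex.exp (2 * Real.pi * Complex.I * (val ws b * val ws.reverse b') / 2 ^ ws.length)
  else 0

theorem fourier_nil : fourier ([] : List Q) = 1 := by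
  ext b' b
  simp [fourier, Matrix.one_apply, val, funext_iff]

theorem fourier_singleton (t : Q) : fourier [t] = (Gate.H t).op := by
  ext b' b
  simp only [fourier, Gate.op, Matrix.of_apply, List.mem_singleton, List.reverse_singleton, val,
    bit, List.length_singleton, pow_one]
  refine if_congr Iff.rfl ?_ rfl
  have h : Complex.exp (2 * Real.pi * Complex.I / 2) = -1 := by
    rw [← Complex.exp_pi_mul_I]; congr 1; ring
  cases b t <;> cases b' t <;> simp [h]
  rw [neg_div, one_div]

/-- Of the four terms of the exponent, two give the transforms of the halves, low input times high
output gives the phase product, and high input times low output is an integer multiple of `2πi`. -/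
theorem fourier_append {lo hi : List Q} (hd : lo.Disjoint hi) :
    fourier (lo ++ hi) = fourier lo * (Matrix.diagonal (fun b => Complex.exp
      (Complex.I * ((2 * Real.pi / 2 ^ (lo.length + hi.length) : ℝ) : ℂ) *
        ((val lo b * val hi.reverse b : ℚ) : ℂ))) * fourier hi) := by
  ext b' b
  -- The only contributing intermediate state: `hi` is already transformed, `lo` is not.
  let b₀ : Q → Bool := fun q => if q ∈ lo then b q else b' q
  have hlo : ∀ q ∈ lo, b₀ q = b q := fun q hq => if_pos hq
  have hnlo : ∀ q, q ∉ lo → b₀ q = b' q := fun q hq => if_neg hq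
  rw [Matrix.mul_apply, Finset.sum_eq_single b₀]
  · rw [Matrix.diagonal_mul]
    have hiff : (∀ q, q ∉ lo ++ hi → b' q = b q) ↔ ∀ q, q ∉ hi → b₀ q = b q := by
      constructor
      · intro h q hq
        by_cases hql : q ∈ lo
        · exact hlo q hql
        · rw [hnlo q hql, h q (by simp [hq, hql])]
      · intro h q hq
        simp only [List.mem_append, not_or] at hq
        rw [← hnlo q hq.1, h q hq.2]
    have h₀ : ∀ q, q ∉ lo → b' q = b₀ q := fun q hq => (hnlo q hq).symm
    simp only [fourier, Matrix.of_apply]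
    rw [if_pos h₀]
    by_cases h : ∀ q, q ∉ lo ++ hi → b' q = b q
    · rw [if_pos h, if_pos (hiff.1 h)]
      have v₁ : val lo b₀ = val lo b := val_congr hlo
      have v₂ : val hi.reverse b₀ = val hi.reverse b' := val_congr fun q hq =>
        hnlo q fun h' => hd h' (List.mem_reverse.1 hq)
      rw [v₁, v₂, List.reverse_append, val_append, val_append, List.length_append,
        List.length_reverse, pow_add]
      suffices key : ∀ r x y z w : ℂ, x = y * z * w →
          r ^ lo.length * r ^ hi.length * x = r ^ lo.length * y * (z * (r ^ hi.length * w)) by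
        refine key _ _ _ _ _ ?_
        rw [← Complex.exp_add, ← Complex.exp_add, Complex.exp_eq_exp_iff_exists_int]
        refine ⟨(val hi b * val lo.reverse b' : ℕ), ?_⟩
        push_cast
        rw [pow_add]
        field_simp
        ring
      intro r x y z w hx
      rw [hx]; ring
    · rw [if_neg h, if_neg fun h' => h (hiff.2 h'), mul_zero, mul_zero]
  · intro c _ hc
    rw [Matrix.diagonal_mul]
    simp only [fourier, Matrix.of_apply]
    by_cases h₁ : ∀ q, q ∉ lo → b' q = c q
    · by_cases h₂ : ∀ q, q ∉ hi → c q = b q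
      · refine absurd (funext fun q => ?_) hc
        by_cases hq : q ∈ lo
        · rw [hlo q hq, h₂ q fun h => hd hq h]
        · rw [hnlo q hq, h₁ q hq]
      · rw [if_neg h₂, mul_zero, mul_zero]
    · rw [if_neg h₁, zero_mul]
  · simp

theorem exists_fourier_append {lo hi : List Q} (hd : lo.Disjoint hi) {s t p : ℕ}
    (hlo : ∃ C : Circuit ℝ Q, C.length ≤ s ∧ C.op = fourier lo)
    (hhi : ∃ C : Circuit ℝ Q, C.length ≤ t ∧ C.op = fourier hi)
    (hp : HasPhaseCircuit (fun b => (val lo b * val hi.reverse b : ℚ)) p) :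
    ∃ C : Circuit ℝ Q, C.length ≤ s + t + p ∧ C.op = fourier (lo ++ hi) := by
  obtain ⟨C, hC, hC'⟩ := hlo
  obtain ⟨D, hD, hD'⟩ := hhi
  obtain ⟨T, -, hT, hT'⟩ := hp.exists_circuit
  refine ⟨D ++ T.scale (2 * Real.pi / 2 ^ (lo.length + hi.length)) ++ C, ?_, ?_⟩
  · rw [List.length_append, List.length_append, Circuit.length_scale]; omega
  · rw [Circuit.op_append, Circuit.op_append, hC', hD', hT', fourier_append hd]

theorem exists_fourier_bound {α K : ℝ} (hα : 1 < α) (hK : 0 ≤ K)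
    (hP : ∀ N : ℕ, ∃ t : ℕ, (t : ℝ) ≤ K * (N : ℝ) ^ α ∧
      ∀ xs zs : List Q, xs.Nodup → zs.Nodup → xs.Disjoint zs → xs.length ≤ N → zs.length ≤ N →
        HasPhaseCircuit (fun b => (val xs b * val zs b : ℚ)) t) (m : ℕ) :
    ∃ t : ℕ, (t : ℝ) ≤ (2 * K + 1) / (1 - 2 ^ (1 - α)) * (m : ℝ) ^ α ∧
      ∀ ws : List Q, ws.Nodup → ws.length = m →
        ∃ C : Circuit ℝ Q, C.length ≤ t ∧ C.op = fourier ws := by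
  have hδ : (2 : ℝ) ^ (1 - α) < 1 := Real.rpow_lt_one_of_one_lt_of_neg (by norm_num) (by linarith)
  have hδ₀ : 0 < (2 : ℝ) ^ (1 - α) := by positivity
  set δ : ℝ := 2 ^ (1 - α) with hδdef
  set M : ℝ := (2 * K + 1) / (1 - δ) with hM
  -- `M` is the fixed point of the recursion, since two halves cost `δ` times the bound for the
  -- whole; `δ < 1` because `α > 1`.
  have hMδ : M * δ + (2 * K + 1) = M := by
    rw [hM]; field_simp [(by linarith : 1 - δ ≠ 0)]; ring
  have hM₁ : 1 ≤ M := by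
    rw [hM, le_div_iff₀ (by linarith)]; linarith
  induction m using Nat.strong_induction_on with
  | _ m ih =>
  rcases Nat.lt_or_ge m 2 with hm | hm
  · interval_cases m
    · refine ⟨0, by simp [Real.zero_rpow (by linarith : α ≠ 0)], fun ws _ hws => ⟨[], by simp, ?_⟩⟩
      rw [List.length_eq_zero_iff.1 hws, fourier_nil]; rfl
    · refine ⟨1, by simpa using hM₁, fun ws _ hws => ?_⟩
      obtain ⟨q, rfl⟩ := List.length_eq_one_iff.1 hws
      exact ⟨[.H q], by simp, by rw [fourier_singleton]; simp [Circuit.op]⟩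
  · obtain ⟨t, ht, h⟩ := ih (m / 2) (by omega)
    obtain ⟨p, hp, hph⟩ := hP m
    have heven : ∀ ws : List Q, ws.Nodup → ws.length = 2 * (m / 2) →
        ∃ C : Circuit ℝ Q, C.length ≤ t + t + p ∧ C.op = fourier ws := by
      intro ws hnd hws
      have hd := List.disjoint_take_drop hnd (le_refl (m / 2))
      rw [← List.take_append_drop (m / 2) ws]
      have hl : (ws.take (m / 2)).length = m / 2 := by rw [List.length_take]; omega
      have hl' : (ws.drop (m / 2)).length = m / 2 := by rw [List.length_drop]; omega
      have hn := hnd.sublist (List.take_sublist (m / 2) ws)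
      have hn' := hnd.sublist (List.drop_sublist (m / 2) ws)
      refine exists_fourier_append hd (h _ hn hl) (h _ hn' hl')
        (hph _ _ hn (List.nodup_reverse.2 hn') (fun q hq hq' => hd hq (List.mem_reverse.1 hq'))
        (by omega) (by rw [List.length_reverse]; omega))
    -- For odd `m` one qubit is split off first, at the price of one Hadamard gate and a second
    -- phase product.
    refine ⟨2 * t + 2 * p + 1, ?_, fun ws hnd hws => ?_⟩
    · have hm' : (2 : ℝ) ≤ m := by exact_mod_cast hm
      have h₁ : (1 : ℝ) ≤ (m : ℝ) ^ α := Real.one_le_rpow (by linarith) (by linarith)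
      have h₂ : 2 * ((m / 2 : ℕ) : ℝ) ^ α ≤ δ * (m : ℝ) ^ α := by
        have : ((m / 2 : ℕ) : ℝ) ^ α ≤ ((m : ℝ) / 2) ^ α :=
          Real.rpow_le_rpow (by positivity) Nat.cast_div_le (by linarith)
        rw [Real.div_rpow (by positivity) (by norm_num)] at this
        calc 2 * ((m / 2 : ℕ) : ℝ) ^ α ≤ 2 * ((m : ℝ) ^ α / 2 ^ α) := by gcongr
          _ = δ * (m : ℝ) ^ α := by
            rw [hδdef, Real.rpow_sub (by norm_num), Real.rpow_one]; ring
      have h₃ : M * (2 * ((m / 2 : ℕ) : ℝ) ^ α) ≤ M * (δ * (m : ℝ) ^ α) := by gcongr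
      have h₄ : M * (m : ℝ) ^ α = M * (δ * (m : ℝ) ^ α) + (2 * K + 1) * (m : ℝ) ^ α := by
        conv_lhs => rw [← hMδ]
        ring
      push_cast
      linarith
    · rcases Nat.even_or_odd' m with ⟨j, hj | hj⟩
      · obtain ⟨C, hC, hC'⟩ := heven ws hnd (by omega)
        exact ⟨C, by omega, hC'⟩
      · obtain _ | ⟨q, ws⟩ := ws
        · simp at hws; omega
        rw [List.nodup_cons] at hnd
        rw [List.length_cons] at hws
        have hd : [q].Disjoint ws := by simpa using hnd.1
        obtain ⟨C, hC, hC'⟩ := exists_fourier_append hd (s := 1)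
          ⟨[.H q], by simp, by rw [fourier_singleton]; simp [Circuit.op]⟩
          (heven ws hnd.2 (by omega)) (hph _ _ (List.nodup_singleton q)
            (List.nodup_reverse.2 hnd.2) (fun r hr hr' => hd hr (List.mem_reverse.1 hr'))
            (by simp; omega) (by rw [List.length_reverse]; omega))
        exact ⟨C, by omega, hC'⟩

end Fourier

/-! ### Classical-quantum multiplication -/

/-- The basis state to which `|b⟩` is sent by the multiplication. -/
def mulState {n m : ℕ} (a : ℤ) (b : Fin n ⊕ Fin m → Bool) : Fin n ⊕ Fin m → Bool :=
  Sum.elim (fun i => b (Sum.inl i))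
    fun j => ((sndVal b + a * fstVal b) % 2 ^ m).toNat.testBit j

theorem fstVal_mulState {n m : ℕ} (a : ℤ) (b : Fin n ⊕ Fin m → Bool) :
    fstVal (mulState a b) = fstVal b := rfl

theorem sndVal_mulState {n m : ℕ} (a : ℤ) (b : Fin n ⊕ Fin m → Bool) :
    (sndVal (mulState a b) : ℤ) = (sndVal b + a * fstVal b) % 2 ^ m := by
  have h : sndVal (mulState a b) = ((sndVal b + a * fstVal b) % 2 ^ m).toNat % 2 ^ m :=
    Nat.ofBits_testBit _ m
  have h₀ : 0 ≤ ((sndVal b : ℤ) + a * fstVal b) % 2 ^ m := Int.emod_nonneg _ (by positivity)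
  rw [h]
  push_cast
  rw [Int.toNat_of_nonneg h₀, Int.emod_emod]

theorem ofBits_injective {n : ℕ} : Function.Injective (Nat.ofBits (n := n)) := by
  intro f g h
  funext i
  rw [← Nat.testBit_ofBits_lt f i i.2, h, Nat.testBit_ofBits_lt g i i.2]

theorem cqMul_apply {n m : ℕ} (a : ℤ) (b' b : Fin n ⊕ Fin m → Bool) :
    cqMul n m a b' b = if b' = mulState a b then 1 else 0 := by
  rw [cqMul, Matrix.of_apply]
  refine if_congr ⟨fun ⟨h₁, h₂⟩ => ?_, fun h => ?_⟩ rfl rfl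
  · rw [← sndVal_mulState, Nat.cast_inj] at h₂
    rw [← fstVal_mulState a b] at h₁
    have e₁ := ofBits_injective h₁
    have e₂ := ofBits_injective h₂
    funext q
    cases q with
    | inl i => exact congrFun e₁ i
    | inr j => exact congrFun e₂ j
  · rw [h]
    exact ⟨fstVal_mulState a b, sndVal_mulState a b⟩

/-- The Fourier transform of the second register turns the multiplication into a phase product. -/
theorem phase_mul_fourier (n m : ℕ) (a : ℤ) :
    Matrix.diagonal (fun b : Fin n ⊕ Fin m → Bool => Complex.exp
      (Complex.I * ((2 * Real.pi * a / 2 ^ m : ℝ) : ℂ) *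
        ((val (fstList n m) b * val (sndList n m).reverse b : ℚ) : ℂ))) * fourier (sndList n m) =
    fourier (sndList n m) * cqMul n m a := by
  ext b' b
  rw [Matrix.diagonal_mul, Matrix.mul_apply, Finset.sum_eq_single (mulState a b)]
  · have hlen : (sndList n m).length = m := by simp [sndList]
    have hmem : ∀ q : Fin n ⊕ Fin m, q ∉ sndList n m → ∃ i, q = Sum.inl i := by
      rintro (i | j) h
      · exact ⟨i, rfl⟩
      · exact absurd (List.mem_ofFn.2 ⟨j, rfl⟩) h
    have hstate : ∀ q, q ∉ sndList n m → mulState a b q = b q := by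
      intro q hq
      obtain ⟨i, rfl⟩ := hmem q hq
      rfl
    rw [cqMul_apply, if_pos rfl, mul_one]
    simp only [fourier, Matrix.of_apply]
    by_cases h : ∀ q, q ∉ sndList n m → b' q = b q
    · have h' : ∀ q, q ∉ sndList n m → b' q = mulState a b q := fun q hq => by
        rw [hstate q hq, h q hq]
      rw [if_pos h, if_pos h', mul_left_comm]
      congr 1
      rw [← Complex.exp_add, Complex.exp_eq_exp_iff_exists_int, hlen]
      have hfst : val (fstList n m) b' = fstVal b := by
        rw [← val_fstList]
        refine val_congr fun q hq => h q fun hq' => disjoint_fstList_sndList n m hq hq'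
      rw [hfst, val_sndList, val_sndList]
      have hmod := sndVal_mulState a b
      have hdiv := Int.emod_add_mul_ediv ((sndVal b : ℤ) + a * fstVal b) (2 ^ m)
      rw [← hmod] at hdiv
      have hC : (sndVal (mulState a b) : ℂ) +
          2 ^ m * ((((sndVal b : ℤ) + a * fstVal b) / 2 ^ m : ℤ) : ℂ) =
            sndVal b + a * fstVal b := by exact_mod_cast congrArg (Int.cast : ℤ → ℂ) hdiv
      generalize ((((sndVal b : ℤ) + a * fstVal b) / 2 ^ m : ℤ)) = d at hC
      -- Reduction modulo `2 ^ m` removes `d` multiples of `2 ^ m`, which changes the exponent by an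
      -- integer multiple of `2πi`.
      refine ⟨d * val (sndList n m).reverse b', ?_⟩
      push_cast
      field_simp
      linear_combination -(val (sndList n m).reverse b' : ℂ) * hC
    · have h' : ¬ ∀ q, q ∉ sndList n m → b' q = mulState a b q := fun h' => h fun q hq => by
        rw [h' q hq, hstate q hq]
      rw [if_neg h, if_neg h', mul_zero]
  · intro c _ hc
    rw [cqMul_apply, if_neg hc, mul_zero]
  · simp

theorem exists_cqMul_circuit {k : ℕ} (hk : 2 ≤ k) : ∃ K : ℝ, 0 ≤ K ∧ ∀ (n m : ℕ) (a : ℤ),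
    ∃ C : Circuit ℝ (Fin n ⊕ Fin m),
      (C.length : ℝ) ≤ K * ((max n m : ℕ) : ℝ) ^ Real.logb k (2 * k - 1) ∧
      C.op = cqMul n m a := by
  obtain ⟨K, hK₀, hK⟩ := exists_phase_bound hk
  have hα := one_lt_logb_two_mul_sub_one hk
  set α := Real.logb k (2 * k - 1)
  have hδ : (2 : ℝ) ^ (1 - α) < 1 := Real.rpow_lt_one_of_one_lt_of_neg (by norm_num) (by linarith)
  set M := (2 * K + 1) / (1 - (2 : ℝ) ^ (1 - α)) with hM
  have hM₀ : 0 ≤ M := div_nonneg (by linarith) (by linarith)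
  refine ⟨2 * M + K, by linarith, fun n m a => ?_⟩
  obtain ⟨t, ht, h⟩ := exists_fourier_bound hα hK₀ (hK (Fin n ⊕ Fin m)) m
  obtain ⟨p, hp, hph⟩ := hK (Fin n ⊕ Fin m) (max n m)
  obtain ⟨F, hF, hF'⟩ := h (sndList n m) (nodup_sndList n m) (by simp [sndList])
  obtain ⟨T, -, hT, hT'⟩ := (hph (fstList n m) (sndList n m).reverse (nodup_fstList n m)
    (List.nodup_reverse.2 (nodup_sndList n m))
    (fun q hq hq' => disjoint_fstList_sndList n m hq (List.mem_reverse.1 hq'))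
    (by simp [fstList]) (by simp [sndList])).exists_circuit
  refine ⟨F ++ T.scale (2 * Real.pi * a / 2 ^ m) ++ F.inv, ?_, ?_⟩
  · have hlen : (F ++ T.scale (2 * Real.pi * a / 2 ^ m) ++ F.inv).length ≤ 2 * t + p := by
      rw [List.length_append, List.length_append, Circuit.length_scale, Circuit.inv,
        List.length_reverse, List.length_map]
      omega
    have hlen' : ((F ++ T.scale (2 * Real.pi * a / 2 ^ m) ++ F.inv).length : ℝ) ≤ 2 * t + p := by
      exact_mod_cast hlen
    have hmono : M * (m : ℝ) ^ α ≤ M * ((max n m : ℕ) : ℝ) ^ α :=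
      mul_le_mul_of_nonneg_left (Real.rpow_le_rpow (by positivity)
        (by exact_mod_cast le_max_right n m) (by linarith)) hM₀
    linarith
  · rw [Circuit.op_append, Circuit.op_append, hT', hF', phase_mul_fourier, ← Matrix.mul_assoc,
      ← hF', Circuit.op_inv_mul, Matrix.one_mul]

/-- The exponents `log_k (2k-1)` come arbitrarily close to 1. -/
theorem exists_logb_le {ε : ℝ} (hε : 0 < ε) :
    ∃ k : ℕ, 2 ≤ k ∧ Real.logb k (2 * k - 1) ≤ 1 + ε := by
  have h := (tendsto_rpow_atTop hε).comp (tendsto_natCast_atTop_atTop (R := ℝ))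
  obtain ⟨k, hk, hk'⟩ := ((h.eventually_ge_atTop 2).and (Filter.eventually_ge_atTop 2)).exists
  have hk₂ : (2 : ℝ) ≤ k := by exact_mod_cast hk'
  refine ⟨k, hk', ?_⟩
  rw [Real.logb_le_iff_le_rpow (by linarith) (by linarith), Real.rpow_add (by linarith),
    Real.rpow_one]
  have : (2 : ℝ) ≤ (k : ℝ) ^ ε := hk
  nlinarith

end QCircuit

theorem mainTheorem1 :
    -- PhaseProduct, with gate count O(N ^ log_k (2k-1)), N the larger register size
    (∀ k : ℕ, 2 ≤ k → ∃ K : ℝ, ∀ n m : ℕ, ∃ T : QCircuit.Circuit ℚ (Fin n ⊕ Fin m),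
      T.HadamardFree ∧
      (T.length : ℝ) ≤ K * ((max n m : ℕ) : ℝ) ^ Real.logb k (2 * k - 1) ∧
      ∀ φ : ℝ, (T.scale φ).op = QCircuit.phaseProduct n m φ) ∧
    -- classical-quantum multiplication, with the same gate count
    (∀ k : ℕ, 2 ≤ k → ∃ K : ℝ, ∀ (n m : ℕ) (a : ℤ), ∃ C : QCircuit.Circuit ℝ (Fin n ⊕ Fin m),
      (C.length : ℝ) ≤ K * ((max n m : ℕ) : ℝ) ^ Real.logb k (2 * k - 1) ∧
      C.op = QCircuit.cqMul n m a) ∧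
    -- classical-quantum multiplication, with gate count O(N ^ (1+ε))
    (∀ ε : ℝ, 0 < ε → ∃ K : ℝ, ∀ (n m : ℕ) (a : ℤ), ∃ C : QCircuit.Circuit ℝ (Fin n ⊕ Fin m),
      (C.length : ℝ) ≤ K * ((max n m : ℕ) : ℝ) ^ (1 + ε) ∧
      C.op = QCircuit.cqMul n m a) := by
  refine ⟨fun k hk => QCircuit.exists_phaseProduct_circuit hk, fun k hk => ?_, fun ε hε => ?_⟩
  · obtain ⟨K, -, h⟩ := QCircuit.exists_cqMul_circuit hk
    exact ⟨K, h⟩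
  · obtain ⟨k, hk, hkε⟩ := QCircuit.exists_logb_le hε
    obtain ⟨K, hK, h⟩ := QCircuit.exists_cqMul_circuit hk
    refine ⟨K, fun n m a => ?_⟩
    obtain ⟨C, hC, hC'⟩ := h n m a
    refine ⟨C, hC.trans (mul_le_mul_of_nonneg_left ?_ hK), hC'⟩
    have hα := QCircuit.one_lt_logb_two_mul_sub_one hk
    -- Powers increase with the exponent only for bases at least 1; for base 0 both sides vanish.
    rcases Nat.eq_zero_or_pos (max n m) with h0 | hpos
    · rw [h0, Nat.cast_zero, Real.zero_rpow (by linarith), Real.zero_rpow (by linarith)]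
    · exact Real.rpow_le_rpow_of_exponent_le (by exact_mod_cast hpos) hkε
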